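/- \textbf{Theorem.} Let $\mathbb D$ be a pseudo-double category with category of objects and arrows $\mathbb D_0$, category of proarrows and cells $\mathbb D_1$, external unit functor $y\colon\mathbb D_0\to\mathbb D_1$ and external composition $\otimes$ (written in diagrammatic order). Suppose that: \begin{enumerate} \item $\mathbb D$ is an equipment: every arrow $f\colon A\to B$ has a companion $f_!\colon A\nrightarrow B$ and a conjoint $f^*\colon B\nrightarrow A$; \item $\mathbb D$ is cartesian: the double functors $\Delta\colon\mathbb D\to\mathbb D\times\mathbb D$ and $\mathbb D\to\mathbf 1$ have right adjoints in the 2-category of double categories, pseudo double functors and vertical transformations; \item $\mathbb D$ is unit-pure: $y\colon\mathbb D_0\to\mathbb D_1$ is full; \item $\mathbb D$ has tabulators: $y\colon\mathbb D_0\to\mathbb D_1$ has a right adjoint $\top$; the tabulator of a proarrow $p\colon A\nrightarrow B$ is $\top p$ with the counit cell $y_{\top p}\Rightarrow p$, whose source and target are denoted $l\colon\top p\to A$ and $r\colon\top p\to B$. \end{enumerate} Call an arrow $e\colon A\to E$ a \emph{cover} if the canonical globular cell $e^*\otimes e_!\Rightarrow y_E$ is invertible, and an arrow $m\colon E\to B$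 an \emph{inclusion} if the canonical globular cell $y_E\Rightarrow m_!\otimes m^*$ is invertible. For proarrows $m,n\colon A\nrightarrow B$ let $m\wedge n=\Delta_!\otimes(m\times n)\otimes\Delta^*$ be their local product, the restriction of $m\times n$ along the diagonals of $A$ and $B$. Suppose moreover that: \begin{enumerate} \setcounter{enumi}{4} \item tabulators are jointly inclusions: $\langle l,r\rangle\colon\top p\to A\times B$ is an inclusion for every proarrow $p\colon A\nrightarrow B$; \item every inclusion $m\colon A\to B$ is regular: the canonical cell $y_A\Rightarrow m^*\otimes m_!$ with source and target $m$ exhibits $A$ as the tabulator of $m^*\otimes m_!$; \item (Beck--Chevalley) for every pullback square $fp=gq$ in $\mathbb D_0$, with $p\colon P\to A$, $q\colon P\to B$, $f\colon A\to C$, $g\colon B\to C$, the canonical globular cell $p^*\otimes q_!\Rightarrow f_!\otimes g^*$ is invertible; \item (Frobenius) for every arrow $f\colon A\to B$ and all proarrows $r\colon B\nrightarrow X$ and $q\colon A\nrightarrow X$ there is a globular isomorphism $r\wedge(f^*\otimes q)\cong f^*\otimes((f_!\otimes r)\wedge q)$. \end{enumerate} Then the covers $\mathcal E$ and the inclusions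 $\mathcal M$ form a proper, stable orthogonal factorization system on $\mathbb D_0$. That is: both classes contain all isomorphisms and are closed under composition; every arrow of $\mathbb D_0$ factors as a cover followed by an inclusion; every commutative square from a cover to an inclusion has a unique diagonal filler; every cover is an epimorphism and every inclusion is a monomorphism; and $\mathbb D_0$ has pullbacks, along which covers are stable. -/

import Mathlib

open CategoryTheory

set_option linter.unusedVariables false
set_option linter.checkUnivs false

-- Hom-types are read off the category structure directly, not through its reflexive quiver.
attribute [-instance] catToReflQuiver

universe u v w t u' v' w' t' u'' v'' w'' t''

/-- The objects of the category `D₁` of a double category: proarrows together with their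
endpoints. -/
structure Proarrow {C : Type u} (P : C → C → Type w) where
  of ::
  {left : C}
  {right : C}
  pro : P left right

/-- A pseudo-double category: a category `D₀` (objects and arrows), a category `D₁` (proarrows and
cells), source and target functors `D₁ ⥤ D₀` (on objects these are `left` and `right`), an external
unit functor `y`, and an external composition `⊗` (in diagrammatic order) that is associative and
unital up to coherent globular natural isomorphism. -/
structure DoubleCat : Type (max (u + 1) (v + 1) (w + 1) (t + 1)) where
  Obj : Type u
  [cat₀ : Category.{v} Obj]
  Pro : Obj → Obj → Type w
  [cat₁ : Category.{t} (Proarrow Pro)]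
  src : ∀ {m n : Proarrow Pro}, (m ⟶ n) → (m.left ⟶ n.left)
  tgt : ∀ {m n : Proarrow Pro}, (m ⟶ n) → (m.right ⟶ n.right)
  src_id : ∀ m : Proarrow Pro, src (𝟙 m) = 𝟙 m.left
  tgt_id : ∀ m : Proarrow Pro, tgt (𝟙 m) = 𝟙 m.right
  src_comp : ∀ {m n p : Proarrow Pro} (α : m ⟶ n) (β : n ⟶ p), src (α ≫ β) = src α ≫ src β
  tgt_comp : ∀ {m n p : Proarrow Pro} (α : m ⟶ n) (β : n ⟶ p), tgt (α ≫ β) = tgt α ≫ tgt β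
  -- external units
  unit : ∀ A : Obj, Pro A A
  unitMap : ∀ {A B : Obj}, (A ⟶ B) → (Proarrow.of (unit A) ⟶ Proarrow.of (unit B))
  src_unitMap : ∀ {A B : Obj} (f : A ⟶ B), src (unitMap f) = f
  tgt_unitMap : ∀ {A B : Obj} (f : A ⟶ B), tgt (unitMap f) = f
  unitMap_id : ∀ A : Obj, unitMap (𝟙 A) = 𝟙 _
  unitMap_comp : ∀ {A B C : Obj} (f : A ⟶ B) (g : B ⟶ C),
    unitMap (f ≫ g) = unitMap f ≫ unitMap g
  -- external composition
  tensor : ∀ {A B C : Obj}, Pro A B → Pro B C → Pro A C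
  hcomp : ∀ {A B C A' B' C' : Obj} {m : Pro A B} {n : Pro B C} {m' : Pro A' B'} {n' : Pro B' C'}
    (α : Proarrow.of m ⟶ Proarrow.of m') (β : Proarrow.of n ⟶ Proarrow.of n'),
    tgt α = src β → (Proarrow.of (tensor m n) ⟶ Proarrow.of (tensor m' n'))
  src_hcomp : ∀ {A B C A' B' C' : Obj} {m : Pro A B} {n : Pro B C} {m' : Pro A' B'}
    {n' : Pro B' C'} (α : Proarrow.of m ⟶ Proarrow.of m') (β : Proarrow.of n ⟶ Proarrow.of n')
    (h : tgt α = src β), src (hcomp α β h) = src α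
  tgt_hcomp : ∀ {A B C A' B' C' : Obj} {m : Pro A B} {n : Pro B C} {m' : Pro A' B'}
    {n' : Pro B' C'} (α : Proarrow.of m ⟶ Proarrow.of m') (β : Proarrow.of n ⟶ Proarrow.of n')
    (h : tgt α = src β), tgt (hcomp α β h) = tgt β
  hcomp_id : ∀ {A B C : Obj} (m : Pro A B) (n : Pro B C),
    hcomp (𝟙 (Proarrow.of m)) (𝟙 (Proarrow.of n)) (by rw [src_id, tgt_id]) = 𝟙 _
  hcomp_comp : ∀ {A B C A' B' C' A'' B'' C'' : Obj} {m : Pro A B} {n : Pro B C} {m' : Pro A' B'}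
    {n' : Pro B' C'} {m'' : Pro A'' B''} {n'' : Pro B'' C''}
    (α : Proarrow.of m ⟶ Proarrow.of m') (β : Proarrow.of n ⟶ Proarrow.of n')
    (α' : Proarrow.of m' ⟶ Proarrow.of m'') (β' : Proarrow.of n' ⟶ Proarrow.of n'')
    (h : tgt α = src β) (h' : tgt α' = src β'),
    hcomp (α ≫ α') (β ≫ β') (by rw [src_comp, tgt_comp, h, h']) = hcomp α β h ≫ hcomp α' β' h'
  -- associator
  assoc : ∀ {A B C E : Obj} (m : Pro A B) (n : Pro B C) (p : Pro C E),
    Proarrow.of (tensor (tensor m n) p) ≅ Proarrow.of (tensor m (tensor n p))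
  src_assoc : ∀ {A B C E : Obj} (m : Pro A B) (n : Pro B C) (p : Pro C E),
    src (assoc m n p).hom = 𝟙 A
  tgt_assoc : ∀ {A B C E : Obj} (m : Pro A B) (n : Pro B C) (p : Pro C E),
    tgt (assoc m n p).hom = 𝟙 E
  assoc_naturality : ∀ {A B C E A' B' C' E' : Obj} {m : Pro A B} {n : Pro B C} {p : Pro C E}
    {m' : Pro A' B'} {n' : Pro B' C'} {p' : Pro C' E'}
    (α : Proarrow.of m ⟶ Proarrow.of m') (β : Proarrow.of n ⟶ Proarrow.of n')
    (γ : Proarrow.of p ⟶ Proarrow.of p') (h : tgt α = src β) (h' : tgt β = src γ),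
    hcomp (hcomp α β h) γ (by rw [tgt_hcomp, h']) ≫ (assoc m' n' p').hom =
      (assoc m n p).hom ≫ hcomp α (hcomp β γ h') (by rw [src_hcomp, h])
  -- unitors
  leftUnitor : ∀ {A B : Obj} (m : Pro A B), Proarrow.of (tensor (unit A) m) ≅ Proarrow.of m
  src_leftUnitor : ∀ {A B : Obj} (m : Pro A B), src (leftUnitor m).hom = 𝟙 A
  tgt_leftUnitor : ∀ {A B : Obj} (m : Pro A B), tgt (leftUnitor m).hom = 𝟙 B
  leftUnitor_naturality : ∀ {A B A' B' : Obj} {m : Pro A B} {m' : Pro A' B'}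
    (α : Proarrow.of m ⟶ Proarrow.of m'),
    hcomp (unitMap (src α)) α (tgt_unitMap _) ≫ (leftUnitor m').hom = (leftUnitor m).hom ≫ α
  rightUnitor : ∀ {A B : Obj} (m : Pro A B), Proarrow.of (tensor m (unit B)) ≅ Proarrow.of m
  src_rightUnitor : ∀ {A B : Obj} (m : Pro A B), src (rightUnitor m).hom = 𝟙 A
  tgt_rightUnitor : ∀ {A B : Obj} (m : Pro A B), tgt (rightUnitor m).hom = 𝟙 B
  rightUnitor_naturality : ∀ {A B A' B' : Obj} {m : Pro A B} {m' : Pro A' B'}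
    (α : Proarrow.of m ⟶ Proarrow.of m'),
    hcomp α (unitMap (tgt α)) (src_unitMap _).symm ≫ (rightUnitor m').hom =
      (rightUnitor m).hom ≫ α
  -- coherence
  pentagon : ∀ {A B C E F : Obj} (m : Pro A B) (n : Pro B C) (p : Pro C E) (q : Pro E F),
    hcomp (assoc m n p).hom (𝟙 (Proarrow.of q)) (by rw [tgt_assoc, src_id]) ≫
        (assoc m (tensor n p) q).hom ≫
        hcomp (𝟙 (Proarrow.of m)) (assoc n p q).hom (by rw [tgt_id, src_assoc]) =
      (assoc (tensor m n) p q).hom ≫ (assoc m n (tensor p q)).hom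
  triangle : ∀ {A B C : Obj} (m : Pro A B) (n : Pro B C),
    (assoc m (unit B) n).hom ≫
        hcomp (𝟙 (Proarrow.of m)) (leftUnitor n).hom (by rw [tgt_id, src_leftUnitor]) =
      hcomp (rightUnitor m).hom (𝟙 (Proarrow.of n)) (by rw [tgt_rightUnitor, src_id])

attribute [instance] DoubleCat.cat₀ DoubleCat.cat₁

namespace DoubleCat

/-- The category `D₁` of proarrows and cells. -/
abbrev One (D : DoubleCat.{u, v, w, t}) : Type (max u w) := Proarrow D.Pro

/-- Cells between two proarrows, with arbitrary source and target arrows. -/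
abbrev Cell (D : DoubleCat.{u, v, w, t}) {A B A' B' : D.Obj} (m : D.Pro A B) (n : D.Pro A' B') :
    Type t :=
  (Proarrow.of m : D.One) ⟶ Proarrow.of n

/-- The external unit functor `y : D₀ ⥤ D₁`. -/
abbrev y (D : DoubleCat.{u, v, w, t}) : D.Obj ⥤ D.One where
  obj A := Proarrow.of (D.unit A)
  map f := D.unitMap f
  map_id := D.unitMap_id
  map_comp := D.unitMap_comp

/-- Two parallel proarrows are isomorphic (by an invertible globular cell). -/
def GlobIso (D : DoubleCat.{u, v, w, t}) {A B : D.Obj} (m n : D.Pro A B) : Prop :=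
  ∃ φ : (Proarrow.of m : D.One) ≅ Proarrow.of n, D.src φ.hom = 𝟙 A ∧ D.tgt φ.hom = 𝟙 B

/-- Proarrows of a product double category are pairs of proarrows, cells are pairs of cells. -/
instance prodCategory (D : DoubleCat.{u, v, w, t}) (E : DoubleCat.{u', v', w', t'}) :
    Category.{max t t'}
      (Proarrow (fun A B : D.Obj × E.Obj => D.Pro A.1 B.1 × E.Pro A.2 B.2)) where
  Hom m n := D.Cell m.pro.1 n.pro.1 × E.Cell m.pro.2 n.pro.2
  id m := (𝟙 (Proarrow.of m.pro.1), 𝟙 (Proarrow.of m.pro.2))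
  comp α β := (α.1 ≫ β.1, α.2 ≫ β.2)

/-- The product of two double categories. -/
abbrev prod (D : DoubleCat.{u, v, w, t}) (E : DoubleCat.{u', v', w', t'}) :
    DoubleCat.{max u u', max v v', max w w', max t t'} where
  Obj := D.Obj × E.Obj
  Pro A B := D.Pro A.1 B.1 × E.Pro A.2 B.2
  cat₁ := prodCategory D E
  src α := (D.src α.1, E.src α.2)
  tgt α := (D.tgt α.1, E.tgt α.2)
  src_id m := Prod.ext (D.src_id _) (E.src_id _)
  tgt_id m := Prod.ext (D.tgt_id _) (E.tgt_id _)
  src_comp α β := Prod.ext (D.src_comp _ _) (E.src_comp _ _)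
  tgt_comp α β := Prod.ext (D.tgt_comp _ _) (E.tgt_comp _ _)
  unit A := (D.unit A.1, E.unit A.2)
  unitMap f := (D.unitMap f.1, E.unitMap f.2)
  src_unitMap f := Prod.ext (D.src_unitMap _) (E.src_unitMap _)
  tgt_unitMap f := Prod.ext (D.tgt_unitMap _) (E.tgt_unitMap _)
  unitMap_id A := Prod.ext (D.unitMap_id _) (E.unitMap_id _)
  unitMap_comp f g := Prod.ext (D.unitMap_comp _ _) (E.unitMap_comp _ _)
  tensor m n := (D.tensor m.1 n.1, E.tensor m.2 n.2)
  hcomp α β h := (D.hcomp α.1 β.1 (congrArg Prod.fst h), E.hcomp α.2 β.2 (congrArg Prod.snd h))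
  src_hcomp α β h := Prod.ext (D.src_hcomp _ _ _) (E.src_hcomp _ _ _)
  tgt_hcomp α β h := Prod.ext (D.tgt_hcomp _ _ _) (E.tgt_hcomp _ _ _)
  hcomp_id m n := Prod.ext (D.hcomp_id _ _) (E.hcomp_id _ _)
  hcomp_comp α β α' β' h h' := Prod.ext
    (D.hcomp_comp _ _ _ _ (congrArg Prod.fst h) (congrArg Prod.fst h'))
    (E.hcomp_comp _ _ _ _ (congrArg Prod.snd h) (congrArg Prod.snd h'))
  assoc m n p :=
    { hom := ((D.assoc m.1 n.1 p.1).hom, (E.assoc m.2 n.2 p.2).hom)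
      inv := ((D.assoc m.1 n.1 p.1).inv, (E.assoc m.2 n.2 p.2).inv)
      hom_inv_id := Prod.ext (Iso.hom_inv_id _) (Iso.hom_inv_id _)
      inv_hom_id := Prod.ext (Iso.inv_hom_id _) (Iso.inv_hom_id _) }
  src_assoc m n p := Prod.ext (D.src_assoc _ _ _) (E.src_assoc _ _ _)
  tgt_assoc m n p := Prod.ext (D.tgt_assoc _ _ _) (E.tgt_assoc _ _ _)
  assoc_naturality α β γ h h' := Prod.ext
    (D.assoc_naturality _ _ _ (congrArg Prod.fst h) (congrArg Prod.fst h'))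
    (E.assoc_naturality _ _ _ (congrArg Prod.snd h) (congrArg Prod.snd h'))
  leftUnitor m :=
    { hom := ((D.leftUnitor m.1).hom, (E.leftUnitor m.2).hom)
      inv := ((D.leftUnitor m.1).inv, (E.leftUnitor m.2).inv)
      hom_inv_id := Prod.ext (Iso.hom_inv_id _) (Iso.hom_inv_id _)
      inv_hom_id := Prod.ext (Iso.inv_hom_id _) (Iso.inv_hom_id _) }
  src_leftUnitor m := Prod.ext (D.src_leftUnitor _) (E.src_leftUnitor _)
  tgt_leftUnitor m := Prod.ext (D.tgt_leftUnitor _) (E.tgt_leftUnitor _)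
  leftUnitor_naturality α :=
    Prod.ext (D.leftUnitor_naturality _) (E.leftUnitor_naturality _)
  rightUnitor m :=
    { hom := ((D.rightUnitor m.1).hom, (E.rightUnitor m.2).hom)
      inv := ((D.rightUnitor m.1).inv, (E.rightUnitor m.2).inv)
      hom_inv_id := Prod.ext (Iso.hom_inv_id _) (Iso.hom_inv_id _)
      inv_hom_id := Prod.ext (Iso.inv_hom_id _) (Iso.inv_hom_id _) }
  src_rightUnitor m := Prod.ext (D.src_rightUnitor _) (E.src_rightUnitor _)
  tgt_rightUnitor m := Prod.ext (D.tgt_rightUnitor _) (E.tgt_rightUnitor _)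
  rightUnitor_naturality α :=
    Prod.ext (D.rightUnitor_naturality _) (E.rightUnitor_naturality _)
  pentagon m n p q := Prod.ext (D.pentagon _ _ _ _) (E.pentagon _ _ _ _)
  triangle m n := Prod.ext (D.triangle _ _) (E.triangle _ _)

/-- The unique proarrow of the terminal double category has a unique cell. -/
instance terminalCategory :
    Category.{0} (Proarrow (fun _ _ : Discrete PUnit.{1} => PUnit.{1})) where
  Hom _ _ := PUnit
  id _ := PUnit.unit
  comp _ _ := PUnit.unit

/-- The terminal double category: one object, one arrow, one proarrow, one cell. -/
abbrev terminal : DoubleCat.{0, 0, 0, 0} where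
  Obj := Discrete PUnit.{1}
  Pro _ _ := PUnit
  cat₁ := terminalCategory
  src _ := eqToHom (Subsingleton.elim _ _)
  tgt _ := eqToHom (Subsingleton.elim _ _)
  src_id _ := Subsingleton.elim _ _
  tgt_id _ := Subsingleton.elim _ _
  src_comp _ _ := Subsingleton.elim _ _
  tgt_comp _ _ := Subsingleton.elim _ _
  unit _ := PUnit.unit
  unitMap _ := PUnit.unit
  src_unitMap _ := Subsingleton.elim _ _
  tgt_unitMap _ := Subsingleton.elim _ _
  unitMap_id _ := rfl
  unitMap_comp _ _ := rfl
  tensor _ _ := PUnit.unit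
  hcomp _ _ _ := PUnit.unit
  src_hcomp _ _ _ := Subsingleton.elim _ _
  tgt_hcomp _ _ _ := Subsingleton.elim _ _
  hcomp_id _ _ := rfl
  hcomp_comp _ _ _ _ _ _ := rfl
  assoc _ _ _ := ⟨PUnit.unit, PUnit.unit, rfl, rfl⟩
  src_assoc _ _ _ := Subsingleton.elim _ _
  tgt_assoc _ _ _ := Subsingleton.elim _ _
  assoc_naturality _ _ _ _ _ := rfl
  leftUnitor _ := ⟨PUnit.unit, PUnit.unit, rfl, rfl⟩
  src_leftUnitor _ := Subsingleton.elim _ _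
  tgt_leftUnitor _ := Subsingleton.elim _ _
  leftUnitor_naturality _ := rfl
  rightUnitor _ := ⟨PUnit.unit, PUnit.unit, rfl, rfl⟩
  src_rightUnitor _ := Subsingleton.elim _ _
  tgt_rightUnitor _ := Subsingleton.elim _ _
  rightUnitor_naturality _ := rfl
  pentagon _ _ _ _ := rfl
  triangle _ _ := rfl

end DoubleCat

/-- A (pseudo) double functor. -/
structure DoubleFunctor (D : DoubleCat.{u, v, w, t}) (E : DoubleCat.{u', v', w', t'}) where
  base : D.Obj ⥤ E.Obj
  pro : ∀ {A B : D.Obj}, D.Pro A B → E.Pro (base.obj A) (base.obj B)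
  cell : ∀ {A B A' B' : D.Obj} {m : D.Pro A B} {n : D.Pro A' B'},
    D.Cell m n → E.Cell (pro m) (pro n)
  src_cell : ∀ {A B A' B' : D.Obj} {m : D.Pro A B} {n : D.Pro A' B'} (α : D.Cell m n),
    E.src (cell α) = base.map (D.src α)
  tgt_cell : ∀ {A B A' B' : D.Obj} {m : D.Pro A B} {n : D.Pro A' B'} (α : D.Cell m n),
    E.tgt (cell α) = base.map (D.tgt α)
  cell_id : ∀ {A B : D.Obj} (m : D.Pro A B), cell (𝟙 (Proarrow.of m)) = 𝟙 _
  cell_comp : ∀ {A B A' B' A'' B'' : D.Obj} {m : D.Pro A B} {n : D.Pro A' B'}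
    {p : D.Pro A'' B''} (α : D.Cell m n) (β : D.Cell n p), cell (α ≫ β) = cell α ≫ cell β
  -- comparison for units
  unitIso : ∀ A : D.Obj,
    (Proarrow.of (E.unit (base.obj A)) : E.One) ≅ Proarrow.of (pro (D.unit A))
  src_unitIso : ∀ A : D.Obj, E.src (unitIso A).hom = 𝟙 (base.obj A)
  tgt_unitIso : ∀ A : D.Obj, E.tgt (unitIso A).hom = 𝟙 (base.obj A)
  unitIso_naturality : ∀ {A B : D.Obj} (f : A ⟶ B),
    E.unitMap (base.map f) ≫ (unitIso B).hom = (unitIso A).hom ≫ cell (D.unitMap f)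
  -- comparison for composites
  tensorIso : ∀ {A B C : D.Obj} (m : D.Pro A B) (n : D.Pro B C),
    (Proarrow.of (E.tensor (pro m) (pro n)) : E.One) ≅ Proarrow.of (pro (D.tensor m n))
  src_tensorIso : ∀ {A B C : D.Obj} (m : D.Pro A B) (n : D.Pro B C),
    E.src (tensorIso m n).hom = 𝟙 (base.obj A)
  tgt_tensorIso : ∀ {A B C : D.Obj} (m : D.Pro A B) (n : D.Pro B C),
    E.tgt (tensorIso m n).hom = 𝟙 (base.obj C)
  tensorIso_naturality : ∀ {A B C A' B' C' : D.Obj} {m : D.Pro A B} {n : D.Pro B C}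
    {m' : D.Pro A' B'} {n' : D.Pro B' C'} (α : D.Cell m m') (β : D.Cell n n')
    (h : D.tgt α = D.src β),
    E.hcomp (cell α) (cell β) (by rw [src_cell, tgt_cell, h]) ≫ (tensorIso m' n').hom =
      (tensorIso m n).hom ≫ cell (D.hcomp α β h)
  -- coherence
  assoc_coherence : ∀ {A B C A' : D.Obj} (m : D.Pro A B) (n : D.Pro B C) (p : D.Pro C A'),
    E.hcomp (tensorIso m n).hom (𝟙 (Proarrow.of (pro p))) (by rw [tgt_tensorIso, E.src_id]) ≫
        (tensorIso (D.tensor m n) p).hom ≫ cell (D.assoc m n p).hom =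
      (E.assoc (pro m) (pro n) (pro p)).hom ≫
        E.hcomp (𝟙 (Proarrow.of (pro m))) (tensorIso n p).hom
          (by rw [src_tensorIso, E.tgt_id]) ≫
        (tensorIso m (D.tensor n p)).hom
  left_unit_coherence : ∀ {A B : D.Obj} (m : D.Pro A B),
    E.hcomp (unitIso A).hom (𝟙 (Proarrow.of (pro m))) (by rw [tgt_unitIso, E.src_id]) ≫
        (tensorIso (D.unit A) m).hom ≫ cell (D.leftUnitor m).hom =
      (E.leftUnitor (pro m)).hom
  right_unit_coherence : ∀ {A B : D.Obj} (m : D.Pro A B),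
    E.hcomp (𝟙 (Proarrow.of (pro m))) (unitIso B).hom (by rw [src_unitIso, E.tgt_id]) ≫
        (tensorIso m (D.unit B)).hom ≫ cell (D.rightUnitor m).hom =
      (E.rightUnitor (pro m)).hom

namespace DoubleFunctor

variable {D : DoubleCat.{u, v, w, t}} {E : DoubleCat.{u', v', w', t'}}

/-- The image of an invertible cell under a double functor. -/
abbrev cellIso (F : DoubleFunctor D E) {A B A' B' : D.Obj} {m : D.Pro A B} {n : D.Pro A' B'}
    (φ : (Proarrow.of m : D.One) ≅ Proarrow.of n) :
    (Proarrow.of (F.pro m) : E.One) ≅ Proarrow.of (F.pro n) where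
  hom := F.cell φ.hom
  inv := F.cell φ.inv
  hom_inv_id := by rw [← F.cell_comp, φ.hom_inv_id, F.cell_id]
  inv_hom_id := by rw [← F.cell_comp, φ.inv_hom_id, F.cell_id]

/-- The identity double functor. -/
abbrev id (D : DoubleCat.{u, v, w, t}) : DoubleFunctor D D where
  base := 𝟭 _
  pro m := m
  cell α := α
  src_cell _ := rfl
  tgt_cell _ := rfl
  cell_id _ := rfl
  cell_comp _ _ := rfl
  unitIso _ := Iso.refl _
  src_unitIso _ := D.src_id _
  tgt_unitIso _ := D.tgt_id _
  unitIso_naturality f := (Category.comp_id _).trans (Category.id_comp _).symm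
  tensorIso _ _ := Iso.refl _
  src_tensorIso _ _ := D.src_id _
  tgt_tensorIso _ _ := D.tgt_id _
  tensorIso_naturality α β h := (Category.comp_id _).trans (Category.id_comp _).symm
  assoc_coherence m n p := by simp [D.hcomp_id]
  left_unit_coherence m := by simp [D.hcomp_id]
  right_unit_coherence m := by simp [D.hcomp_id]

/-- Composition of double functors. -/
abbrev comp {H : DoubleCat.{u'', v'', w'', t''}} (F : DoubleFunctor D E) (G : DoubleFunctor E H) :
    DoubleFunctor D H where
  base := F.base ⋙ G.base
  pro m := G.pro (F.pro m)
  cell α := G.cell (F.cell α)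
  src_cell α := by rw [G.src_cell, F.src_cell]; rfl
  tgt_cell α := by rw [G.tgt_cell, F.tgt_cell]; rfl
  cell_id m := by rw [F.cell_id, G.cell_id]
  cell_comp α β := by rw [F.cell_comp, G.cell_comp]
  unitIso A := G.unitIso (F.base.obj A) ≪≫ G.cellIso (F.unitIso A)
  src_unitIso A := by
    simp [cellIso, H.src_comp, G.src_unitIso, G.src_cell, F.src_unitIso]
  tgt_unitIso A := by
    simp [cellIso, H.tgt_comp, G.tgt_unitIso, G.tgt_cell, F.tgt_unitIso]
  unitIso_naturality f := by
    have h1 := G.unitIso_naturality (F.base.map f)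
    have h2 := congrArg G.cell (F.unitIso_naturality f)
    rw [G.cell_comp, G.cell_comp] at h2
    simp only [Functor.comp_map, Iso.trans_hom, cellIso, Category.assoc]
    rw [← h2, ← Category.assoc, h1, Category.assoc]
  tensorIso m n := G.tensorIso (F.pro m) (F.pro n) ≪≫ G.cellIso (F.tensorIso m n)
  src_tensorIso m n := by
    simp [cellIso, H.src_comp, G.src_tensorIso, G.src_cell, F.src_tensorIso]
  tgt_tensorIso m n := by
    simp [cellIso, H.tgt_comp, G.tgt_tensorIso, G.tgt_cell, F.tgt_tensorIso]
  tensorIso_naturality α β h := by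
    have h1 := G.tensorIso_naturality (F.cell α) (F.cell β) (by rw [F.src_cell, F.tgt_cell, h])
    have h2 := congrArg G.cell (F.tensorIso_naturality α β h)
    rw [G.cell_comp, G.cell_comp] at h2
    simp only [Iso.trans_hom, cellIso, Category.assoc]
    rw [← h2, ← Category.assoc, h1, Category.assoc]
  assoc_coherence m n p := by
    have e1 := H.hcomp_comp (G.tensorIso (F.pro m) (F.pro n)).hom (𝟙 (Proarrow.of (G.pro (F.pro p))))
      (G.cell (F.tensorIso m n).hom) (G.cell (𝟙 (Proarrow.of (F.pro p))))
      (by rw [G.tgt_tensorIso, H.src_id])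
      (by rw [G.tgt_cell, G.src_cell, F.tgt_tensorIso, E.src_id])
    have e2 := H.hcomp_comp (𝟙 (Proarrow.of (G.pro (F.pro m)))) (G.tensorIso (F.pro n) (F.pro p)).hom
      (G.cell (𝟙 (Proarrow.of (F.pro m)))) (G.cell (F.tensorIso n p).hom)
      (by rw [G.src_tensorIso, H.tgt_id])
      (by rw [G.tgt_cell, G.src_cell, F.src_tensorIso, E.tgt_id])
    have n1 := G.tensorIso_naturality (F.tensorIso m n).hom (𝟙 (Proarrow.of (F.pro p)))
      (by rw [F.tgt_tensorIso, E.src_id])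
    have n2 := G.tensorIso_naturality (𝟙 (Proarrow.of (F.pro m))) (F.tensorIso n p).hom
      (by rw [F.src_tensorIso, E.tgt_id])
    have c1 := G.assoc_coherence (F.pro m) (F.pro n) (F.pro p)
    have c2 := congrArg G.cell (F.assoc_coherence m n p)
    simp only [G.cell_comp] at c2
    simp only [G.cell_id, Category.comp_id] at e1 e2 n1 n2
    simp only [Iso.trans_hom, cellIso, Category.assoc]
    rw [e1, e2]
    simp only [Category.assoc]
    rw [reassoc_of% n1, c2, reassoc_of% n2, reassoc_of% c1]
  left_unit_coherence m := by
    have e1 := H.hcomp_comp (G.unitIso (F.base.obj _)).hom (𝟙 (Proarrow.of (G.pro (F.pro m))))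
      (G.cell (F.unitIso _).hom) (G.cell (𝟙 (Proarrow.of (F.pro m))))
      (by rw [G.tgt_unitIso, H.src_id])
      (by rw [G.tgt_cell, G.src_cell, F.tgt_unitIso, E.src_id])
    have n1 := G.tensorIso_naturality (F.unitIso _).hom (𝟙 (Proarrow.of (F.pro m)))
      (by rw [F.tgt_unitIso, E.src_id])
    have c1 := G.left_unit_coherence (F.pro m)
    have c2 := congrArg G.cell (F.left_unit_coherence m)
    simp only [G.cell_comp] at c2
    simp only [G.cell_id, Category.comp_id] at e1 n1
    simp only [Iso.trans_hom, cellIso, Category.assoc]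
    rw [e1]
    simp only [Category.assoc]
    rw [reassoc_of% n1, c2, c1]
  right_unit_coherence m := by
    have e1 := H.hcomp_comp (𝟙 (Proarrow.of (G.pro (F.pro m)))) (G.unitIso (F.base.obj _)).hom
      (G.cell (𝟙 (Proarrow.of (F.pro m)))) (G.cell (F.unitIso _).hom)
      (by rw [G.src_unitIso, H.tgt_id])
      (by rw [G.tgt_cell, G.src_cell, F.src_unitIso, E.tgt_id])
    have n1 := G.tensorIso_naturality (𝟙 (Proarrow.of (F.pro m))) (F.unitIso _).hom
      (by rw [F.src_unitIso, E.tgt_id])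
    have c1 := G.right_unit_coherence (F.pro m)
    have c2 := congrArg G.cell (F.right_unit_coherence m)
    simp only [G.cell_comp] at c2
    simp only [G.cell_id, Category.comp_id] at e1 n1
    simp only [Iso.trans_hom, cellIso, Category.assoc]
    rw [e1]
    simp only [Category.assoc]
    rw [reassoc_of% n1, c2, c1]

/-- The diagonal double functor `D → D × D`. -/
abbrev diag (D : DoubleCat.{u, v, w, t}) : DoubleFunctor D (D.prod D) where
  base := Functor.diag D.Obj
  pro m := (m, m)
  cell α := (α, α)
  src_cell _ := rfl
  tgt_cell _ := rfl
  cell_id _ := rfl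
  cell_comp _ _ := rfl
  unitIso _ := Iso.refl _
  src_unitIso _ := (D.prod D).src_id _
  tgt_unitIso _ := (D.prod D).tgt_id _
  unitIso_naturality f := (Category.comp_id _).trans (Category.id_comp _).symm
  tensorIso _ _ := Iso.refl _
  src_tensorIso _ _ := (D.prod D).src_id _
  tgt_tensorIso _ _ := (D.prod D).tgt_id _
  tensorIso_naturality α β h := (Category.comp_id _).trans (Category.id_comp _).symm
  assoc_coherence m n p := by
    refine Prod.ext ?_ ?_ <;>
    · change D.hcomp (𝟙 _) (𝟙 _) _ ≫ 𝟙 _ ≫ (D.assoc m n p).hom =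
        (D.assoc m n p).hom ≫ D.hcomp (𝟙 _) (𝟙 _) _ ≫ 𝟙 _
      simp [D.hcomp_id]
  left_unit_coherence m := by
    refine Prod.ext ?_ ?_ <;>
    · change D.hcomp (𝟙 _) (𝟙 _) _ ≫ 𝟙 _ ≫ (D.leftUnitor m).hom = (D.leftUnitor m).hom
      simp [D.hcomp_id]
  right_unit_coherence m := by
    refine Prod.ext ?_ ?_ <;>
    · change D.hcomp (𝟙 _) (𝟙 _) _ ≫ 𝟙 _ ≫ (D.rightUnitor m).hom = (D.rightUnitor m).hom
      simp [D.hcomp_id]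

/-- The unique double functor to the terminal double category. -/
abbrev toTerminal (D : DoubleCat.{u, v, w, t}) : DoubleFunctor D DoubleCat.terminal where
  base := Functor.star D.Obj
  pro _ := PUnit.unit
  cell _ := PUnit.unit
  src_cell _ := Subsingleton.elim (α := Discrete.mk PUnit.unit ⟶ Discrete.mk PUnit.unit) _ _
  tgt_cell _ := Subsingleton.elim (α := Discrete.mk PUnit.unit ⟶ Discrete.mk PUnit.unit) _ _
  cell_id _ := rfl
  cell_comp _ _ := rfl
  unitIso _ := Iso.refl _
  src_unitIso _ := DoubleCat.terminal.src_id _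
  tgt_unitIso _ := DoubleCat.terminal.tgt_id _
  unitIso_naturality _ := rfl
  tensorIso _ _ := Iso.refl _
  src_tensorIso _ _ := DoubleCat.terminal.src_id _
  tgt_tensorIso _ _ := DoubleCat.terminal.tgt_id _
  tensorIso_naturality _ _ _ := rfl
  assoc_coherence _ _ _ := rfl
  left_unit_coherence _ := rfl
  right_unit_coherence _ := rfl

end DoubleFunctor

/-- A (vertical) transformation of double functors. -/
structure DoubleTrans {D : DoubleCat.{u, v, w, t}} {E : DoubleCat.{u', v', w', t'}}
    (F G : DoubleFunctor D E) where
  app : ∀ A : D.Obj, F.base.obj A ⟶ G.base.obj A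
  naturality : ∀ {A B : D.Obj} (f : A ⟶ B), F.base.map f ≫ app B = app A ≫ G.base.map f
  cell : ∀ {A B : D.Obj} (m : D.Pro A B), E.Cell (F.pro m) (G.pro m)
  src_cell : ∀ {A B : D.Obj} (m : D.Pro A B), E.src (cell m) = app A
  tgt_cell : ∀ {A B : D.Obj} (m : D.Pro A B), E.tgt (cell m) = app B
  cell_naturality : ∀ {A B A' B' : D.Obj} {m : D.Pro A B} {n : D.Pro A' B'} (α : D.Cell m n),
    F.cell α ≫ cell n = cell m ≫ G.cell α
  unit_compat : ∀ A : D.Obj,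
    (F.unitIso A).hom ≫ cell (D.unit A) = E.unitMap (app A) ≫ (G.unitIso A).hom
  tensor_compat : ∀ {A B C : D.Obj} (m : D.Pro A B) (n : D.Pro B C),
    (F.tensorIso m n).hom ≫ cell (D.tensor m n) =
      E.hcomp (cell m) (cell n) (by rw [src_cell, tgt_cell]) ≫ (G.tensorIso m n).hom

/-- An adjunction `F ⊣ G` in the 2-category of double categories, (pseudo) double functors and
vertical transformations. -/
structure DoubleAdjunction {D : DoubleCat.{u, v, w, t}} {E : DoubleCat.{u', v', w', t'}}
    (F : DoubleFunctor D E) (G : DoubleFunctor E D) where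
  unit : DoubleTrans (DoubleFunctor.id D) (F.comp G)
  counit : DoubleTrans (G.comp F) (DoubleFunctor.id E)
  left_triangle_app : ∀ A : D.Obj,
    F.base.map (unit.app A) ≫ counit.app (F.base.obj A) = 𝟙 (F.base.obj A)
  left_triangle_cell : ∀ {A B : D.Obj} (m : D.Pro A B),
    F.cell (unit.cell m) ≫ counit.cell (F.pro m) = 𝟙 (Proarrow.of (F.pro m))
  right_triangle_app : ∀ A : E.Obj,
    unit.app (G.base.obj A) ≫ G.base.map (counit.app A) = 𝟙 (G.base.obj A)
  right_triangle_cell : ∀ {A B : E.Obj} (m : E.Pro A B),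
    unit.cell (G.pro m) ≫ G.cell (counit.cell m) = 𝟙 (Proarrow.of (G.pro m))

namespace DoubleCat

variable (D : DoubleCat.{u, v, w, t})

/-- `f : A ⟶ B` and the proarrow `f_! : A ⇸ B` form a companion pair. -/
structure Companion {A B : D.Obj} (f : A ⟶ B) where
  pro : D.Pro A B
  unit : D.Cell (D.unit A) pro
  counit : D.Cell pro (D.unit B)
  src_unit : D.src unit = 𝟙 A
  tgt_unit : D.tgt unit = f
  src_counit : D.src counit = f
  tgt_counit : D.tgt counit = 𝟙 B
  unit_hcomp_counit : D.hcomp unit counit (by rw [tgt_unit, src_counit]) =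
    (D.leftUnitor pro).hom ≫ (D.rightUnitor pro).inv
  unit_comp_counit : unit ≫ counit = D.unitMap f

/-- `f : A ⟶ B` and the proarrow `f^* : B ⇸ A` form a conjoint pair. -/
structure Conjoint {A B : D.Obj} (f : A ⟶ B) where
  pro : D.Pro B A
  unit : D.Cell (D.unit A) pro
  counit : D.Cell pro (D.unit B)
  src_unit : D.src unit = f
  tgt_unit : D.tgt unit = 𝟙 A
  src_counit : D.src counit = 𝟙 B
  tgt_counit : D.tgt counit = f
  counit_hcomp_unit : D.hcomp counit unit (by rw [tgt_counit, src_unit]) =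
    (D.rightUnitor pro).hom ≫ (D.leftUnitor pro).inv
  unit_comp_counit : unit ≫ counit = D.unitMap f

/-- An equipment structure: every arrow has a (chosen) companion and a (chosen) conjoint. -/
structure Equipment where
  companion : ∀ {A B : D.Obj} (f : A ⟶ B), D.Companion f
  conjoint : ∀ {A B : D.Obj} (f : A ⟶ B), D.Conjoint f

/-- A cartesian structure: right adjoints, in double categories, double functors and vertical
transformations, of the diagonal `D → D × D` and of the double functor to the terminal double
category. -/
structure Cartesian where
  prodFunctor : DoubleFunctor (D.prod D) D
  prodAdj : DoubleAdjunction (DoubleFunctor.diag D) prodFunctor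
  oneFunctor : DoubleFunctor terminal D
  oneAdj : DoubleAdjunction (DoubleFunctor.toTerminal D) oneFunctor

/-- A double category has tabulators when `y : D₀ ⥤ D₁` has a right adjoint. -/
structure Tabulators where
  top : D.One ⥤ D.Obj
  adj : D.y ⊣ top

/-- A double category is unit-pure when `y : D₀ ⥤ D₁` is full. -/
def IsUnitPure : Prop := D.y.Full

variable {D}

namespace Cartesian

variable (K : D.Cartesian)

/-- The product of two objects. -/
abbrev prodObj (A B : D.Obj) : D.Obj := K.prodFunctor.base.obj (A, B)

/-- The product of two proarrows. -/
abbrev prodPro {A B A' B' : D.Obj} (m : D.Pro A B) (n : D.Pro A' B') :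
    D.Pro (K.prodObj A A') (K.prodObj B B') :=
  K.prodFunctor.pro (A := (A, A')) (B := (B, B')) (m, n)

/-- The diagonal arrow `A ⟶ A × A`. -/
def diagonal (A : D.Obj) : A ⟶ K.prodObj A A := K.prodAdj.unit.app A

/-- The arrow `⟨f, g⟩ : X ⟶ A × B`. -/
def pair {X A B : D.Obj} (f : X ⟶ A) (g : X ⟶ B) : X ⟶ K.prodObj A B :=
  K.diagonal X ≫ K.prodFunctor.base.map (X := (X, X)) (Y := (A, B)) (f, g)

end Cartesian

namespace Equipment

variable (Q : D.Equipment)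

/-- The companion `f_! : A ⇸ B` of `f : A ⟶ B`. -/
abbrev lower {A B : D.Obj} (f : A ⟶ B) : D.Pro A B := (Q.companion f).pro

/-- The conjoint `f^* : B ⇸ A` of `f : A ⟶ B`. -/
abbrev upper {A B : D.Obj} (f : A ⟶ B) : D.Pro B A := (Q.conjoint f).pro

/-- The cokernel `ξ : y_A ⇒ f^* ⊗ f_!` of `f : A ⟶ B`, a cell with source and target `f`. -/
def cokernel {A B : D.Obj} (f : A ⟶ B) : D.Cell (D.unit A) (D.tensor (Q.upper f) (Q.lower f)) :=
  (D.leftUnitor (D.unit A)).inv ≫ D.hcomp (Q.conjoint f).unit (Q.companion f).unit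
    (by rw [(Q.conjoint f).tgt_unit, (Q.companion f).src_unit])

/-- The canonical globular cell `f^* ⊗ f_! ⇒ y_B`. -/
def coverCell {A B : D.Obj} (f : A ⟶ B) : D.Cell (D.tensor (Q.upper f) (Q.lower f)) (D.unit B) :=
  D.hcomp (Q.conjoint f).counit (Q.companion f).counit
    (by rw [(Q.conjoint f).tgt_counit, (Q.companion f).src_counit]) ≫
    (D.leftUnitor (D.unit B)).hom

/-- The canonical globular cell `y_A ⇒ f_! ⊗ f^*`. -/
def inclusionCell {A B : D.Obj} (f : A ⟶ B) :
    D.Cell (D.unit A) (D.tensor (Q.lower f) (Q.upper f)) :=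
  (D.leftUnitor (D.unit A)).inv ≫ D.hcomp (Q.companion f).unit (Q.conjoint f).unit
    (by rw [(Q.companion f).tgt_unit, (Q.conjoint f).src_unit])

/-- Covers: arrows `e` for which the canonical cell `e^* ⊗ e_! ⇒ y` is invertible. -/
def covers : MorphismProperty D.Obj := fun _ _ e => IsIso (Q.coverCell e)

/-- Inclusions: arrows `m` for which the canonical cell `y ⇒ m_! ⊗ m^*` is invertible. -/
def inclusions : MorphismProperty D.Obj := fun _ _ m => IsIso (Q.inclusionCell m)

/-- Tabulators are jointly inclusions: for every proarrow `p : A ⇸ B` with tabulator cell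
`y_{⊤p} ⇒ p`, of source `l` and target `r`, the arrow `⟨l, r⟩ : ⊤p ⟶ A × B` is an inclusion. -/
def TabulatorsJointlyInclusions (K : D.Cartesian) (T : D.Tabulators) : Prop :=
  ∀ p : D.One, Q.inclusions
    (K.pair (D.src (T.adj.counit.app p) : T.top.obj p ⟶ p.left)
      (D.tgt (T.adj.counit.app p) : T.top.obj p ⟶ p.right))

/-- Every inclusion is regular, i.e. it is the tabulator of its cokernel: the cokernel cell is
universal among the cells from external units to the cokernel proarrow. -/
def InclusionsRegular : Prop :=
  ∀ {A B : D.Obj} (m : A ⟶ B), Q.inclusions m →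
    ∀ (X : D.Obj) (θ : D.Cell (D.unit X) (D.tensor (Q.upper m) (Q.lower m))),
      ∃! u : X ⟶ A, D.unitMap u ≫ Q.cokernel m = θ

/-- The canonical globular cell `p^* ⊗ q_! ⇒ f_! ⊗ g^*` of a commutative square. -/
def beckChevalleyCell {P A B C : D.Obj} {p : P ⟶ A} {q : P ⟶ B} {f : A ⟶ C} {g : B ⟶ C}
    (h : p ≫ f = q ≫ g) :
    D.Cell (D.tensor (Q.upper p) (Q.lower q)) (D.tensor (Q.lower f) (Q.upper g)) :=
  D.hcomp ((Q.conjoint p).counit ≫ (Q.companion f).unit)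
    ((Q.companion q).counit ≫ (Q.conjoint g).unit)
    (by rw [D.tgt_comp, D.src_comp, (Q.conjoint p).tgt_counit, (Q.companion f).tgt_unit,
      (Q.companion q).src_counit, (Q.conjoint g).src_unit, h])

/-- The Beck–Chevalley condition: the canonical cell of every pullback square is invertible. -/
def BeckChevalley : Prop :=
  ∀ {P A B C : D.Obj} {p : P ⟶ A} {q : P ⟶ B} {f : A ⟶ C} {g : B ⟶ C}
    (h : IsPullback p q f g), IsIso (Q.beckChevalleyCell h.w)

/-- The restriction `f_! ⊗ n ⊗ g^*` of a proarrow `n` along the arrows `f` and `g`. -/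
abbrev restriction {A B A' B' : D.Obj} (f : A ⟶ A') (n : D.Pro A' B') (g : B ⟶ B') : D.Pro A B :=
  D.tensor (D.tensor (Q.lower f) n) (Q.upper g)

/-- The local product `m ∧ n` of parallel proarrows: the restriction of `m × n` along the
diagonals. -/
def localProd (K : D.Cartesian) {A B : D.Obj} (m n : D.Pro A B) : D.Pro A B :=
  Q.restriction (K.diagonal A) (K.prodPro m n) (K.diagonal B)

/-- Local products satisfy the Frobenius law `r ∧ (f^* ⊗ q) ≅ f^* ⊗ ((f_! ⊗ r) ∧ q)`. -/
def Frobenius (K : D.Cartesian) : Prop :=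
  ∀ {A B X : D.Obj} (f : A ⟶ B) (r : D.Pro B X) (q : D.Pro A X),
    D.GlobIso (Q.localProd K r (D.tensor (Q.upper f) q))
      (D.tensor (Q.upper f) (Q.localProd K (D.tensor (Q.lower f) r) q))

end Equipment

end DoubleCat

/-- An orthogonal factorization system `(E, M)`: both classes contain the isomorphisms and are
closed under composition, every arrow factors as an `E`-arrow followed by an `M`-arrow, and every
`E`-arrow lifts uniquely against every `M`-arrow. -/
structure IsOrthogonalFactorizationSystem {C : Type u} [Category.{v} C]
    (E M : MorphismProperty C) : Prop where
  left_isos : ∀ {X Y : C} (f : X ⟶ Y), IsIso f → E f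
  right_isos : ∀ {X Y : C} (f : X ⟶ Y), IsIso f → M f
  left_comp : ∀ {X Y Z : C} (f : X ⟶ Y) (g : Y ⟶ Z), E f → E g → E (f ≫ g)
  right_comp : ∀ {X Y Z : C} (f : X ⟶ Y) (g : Y ⟶ Z), M f → M g → M (f ≫ g)
  factorization : ∀ {X Y : C} (f : X ⟶ Y),
    ∃ (I : C) (e : X ⟶ I) (m : I ⟶ Y), E e ∧ M m ∧ e ≫ m = f
  unique_lift : ∀ {A B X Y : C} (e : A ⟶ B) (m : X ⟶ Y) (a : A ⟶ X) (b : B ⟶ Y),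
    E e → M m → a ≫ m = e ≫ b → ∃! d : B ⟶ X, e ≫ d = a ∧ d ≫ m = b

/-- Proper: `E`-arrows are epimorphisms and `M`-arrows are monomorphisms. -/
structure IsProperFactorizationSystem {C : Type u} [Category.{v} C]
    (E M : MorphismProperty C) : Prop extends IsOrthogonalFactorizationSystem E M where
  epi : ∀ {X Y : C} (e : X ⟶ Y), E e → Epi e
  mono : ∀ {X Y : C} (m : X ⟶ Y), M m → Mono m

/-- Stable: pullbacks exist, and the left class is stable under them. -/
structure IsStableFactorizationSystem {C : Type u} [Category.{v} C]
    (E M : MorphismProperty C) : Prop extends IsOrthogonalFactorizationSystem E M where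
  hasPullbacks : Limits.HasPullbacks C
  pullback : ∀ {P A B X : C} {d : P ⟶ A} {c : P ⟶ B} {h : A ⟶ X} {e : B ⟶ X},
    IsPullback d c h e → E e → E d

/-! Most of the argument asks only whether a cell with a given boundary exists (`HasCell`). Three
facts make this enough. By unit-purity, a cell between external units has equal source and target,
so an equation of arrows follows from a pasting of cells. As `⟨l, r⟩` is an inclusion, hence monic,
a cell out of an external unit is determined by its boundary. Precomposition with the cokernel of
`e` is faithful on cells out of `e^* ⊗ e_!` with fixed boundary.

Consequently `e : A ⟶ E` is a cover as soon as some globular cell `y_E ⇒ e^* ⊗ e_!` exists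
(`cover_of_hasCell`). Inclusions are exactly the monomorphisms: unit-purity gives one direction,
Beck–Chevalley for the trivial kernel pair the other. The tabulator of `f^* ⊗ f_!` is a subobject of
the codomain through which `f` factors. It is the image of `f`, and an arrow whose monic right
factors all split is a cover (`cover_of_extremal`).

For diagonals, a cover `e` and an inclusion `m` give a composite `y ⇒ e^* ⊗ e_! ⇒ m^* ⊗ m_!`, which
regularity of `m` turns into an arrow. Pullbacks are the tabulators of `f_! ⊗ g^*`. Stability pastes
Beck–Chevalley and Frobenius into the required cell `y ⇒ d^* ⊗ d_!`. -/

namespace DoubleCat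

variable {D : DoubleCat.{u, v, w, t}}

/-! ### Cells with prescribed boundary -/

/-- There is a cell from `m` to `n` with source `f` and target `g`. -/
def HasCell (D : DoubleCat.{u, v, w, t}) {A B A' B' : D.Obj} (m : D.Pro A B) (n : D.Pro A' B')
    (f : A ⟶ A') (g : B ⟶ B') : Prop :=
  ∃ α : D.Cell m n, D.src α = f ∧ D.tgt α = g

/-- The endpoints of `m` and `n` agree only propositionally here, hence `eqToHom`; when both
equalities are `rfl` it is an identity. -/
theorem src_inv {m n : D.One} (φ : m ≅ n) {A : D.Obj} (hm : m.left = A) (hn : n.left = A)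
    (h : D.src φ.hom = eqToHom (hm.trans hn.symm)) :
    D.src φ.inv = eqToHom (hn.trans hm.symm) := by
  have h₁ := D.src_comp φ.inv φ.hom
  rw [φ.inv_hom_id, D.src_id, h] at h₁
  rw [← cancel_mono (eqToHom (hm.trans hn.symm)), ← h₁]
  simp

theorem tgt_inv {m n : D.One} (φ : m ≅ n) {A : D.Obj} (hm : m.right = A) (hn : n.right = A)
    (h : D.tgt φ.hom = eqToHom (hm.trans hn.symm)) :
    D.tgt φ.inv = eqToHom (hn.trans hm.symm) := by
  have h₁ := D.tgt_comp φ.inv φ.hom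
  rw [φ.inv_hom_id, D.tgt_id, h] at h₁
  rw [← cancel_mono (eqToHom (hm.trans hn.symm)), ← h₁]
  simp

namespace HasCell

variable {A B C A' B' C' A'' B'' : D.Obj}

theorem refl (m : D.Pro A B) : D.HasCell m m (𝟙 A) (𝟙 B) :=
  ⟨𝟙 _, D.src_id _, D.tgt_id _⟩

theorem comp {m : D.Pro A B} {n : D.Pro A' B'} {p : D.Pro A'' B''} {f : A ⟶ A'} {g : B ⟶ B'}
    {f' : A' ⟶ A''} {g' : B' ⟶ B''} (h : D.HasCell m n f g) (h' : D.HasCell n p f' g') :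
    D.HasCell m p (f ≫ f') (g ≫ g') := by
  obtain ⟨α, rfl, rfl⟩ := h
  obtain ⟨β, rfl, rfl⟩ := h'
  exact ⟨α ≫ β, D.src_comp _ _, D.tgt_comp _ _⟩

/-- Precomposition with a globular cell. -/
theorem of_glob {m m' : D.Pro A B} {p : D.Pro A' B'} {f : A ⟶ A'} {g : B ⟶ B'}
    (h : D.HasCell m m' (𝟙 A) (𝟙 B)) (hp : D.HasCell m' p f g) : D.HasCell m p f g := by
  simpa using h.comp hp

/-- Postcomposition with a globular cell. -/
theorem glob {m : D.Pro A B} {n n' : D.Pro A' B'} {f : A ⟶ A'} {g : B ⟶ B'}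
    (h : D.HasCell m n f g) (h' : D.HasCell n n' (𝟙 A') (𝟙 B')) : D.HasCell m n' f g := by
  simpa using h.comp h'

theorem tensor {m : D.Pro A B} {n : D.Pro B C} {m' : D.Pro A' B'} {n' : D.Pro B' C'}
    {f : A ⟶ A'} {g : B ⟶ B'} {k : C ⟶ C'} (h : D.HasCell m m' f g) (h' : D.HasCell n n' g k) :
    D.HasCell (D.tensor m n) (D.tensor m' n') f k := by
  obtain ⟨α, rfl, hα⟩ := h
  obtain ⟨β, hβ, rfl⟩ := h'
  exact ⟨D.hcomp α β (hα.trans hβ.symm), D.src_hcomp _ _ _, D.tgt_hcomp _ _ _⟩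

theorem unit (f : A ⟶ B) : D.HasCell (D.unit A) (D.unit B) f f :=
  ⟨D.unitMap f, D.src_unitMap f, D.tgt_unitMap f⟩

theorem iso_inv {m n : D.Pro A B} (φ : (Proarrow.of m : D.One) ≅ Proarrow.of n)
    (hs : D.src φ.hom = 𝟙 A) (ht : D.tgt φ.hom = 𝟙 B) : D.HasCell n m (𝟙 A) (𝟙 B) :=
  ⟨φ.inv, D.src_inv φ (A := A) rfl rfl hs, D.tgt_inv φ (A := B) rfl rfl ht⟩

theorem assoc (m : D.Pro A B) (n : D.Pro B C) (p : D.Pro C A') :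
    D.HasCell (D.tensor (D.tensor m n) p) (D.tensor m (D.tensor n p)) (𝟙 A) (𝟙 A') :=
  ⟨_, D.src_assoc m n p, D.tgt_assoc m n p⟩

theorem assoc_inv (m : D.Pro A B) (n : D.Pro B C) (p : D.Pro C A') :
    D.HasCell (D.tensor m (D.tensor n p)) (D.tensor (D.tensor m n) p) (𝟙 A) (𝟙 A') :=
  iso_inv _ (D.src_assoc m n p) (D.tgt_assoc m n p)

theorem leftUnitor (m : D.Pro A B) : D.HasCell (D.tensor (D.unit A) m) m (𝟙 A) (𝟙 B) :=
  ⟨_, D.src_leftUnitor m, D.tgt_leftUnitor m⟩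

theorem leftUnitor_inv (m : D.Pro A B) : D.HasCell m (D.tensor (D.unit A) m) (𝟙 A) (𝟙 B) :=
  iso_inv _ (D.src_leftUnitor m) (D.tgt_leftUnitor m)

theorem rightUnitor (m : D.Pro A B) : D.HasCell (D.tensor m (D.unit B)) m (𝟙 A) (𝟙 B) :=
  ⟨_, D.src_rightUnitor m, D.tgt_rightUnitor m⟩

theorem rightUnitor_inv (m : D.Pro A B) : D.HasCell m (D.tensor m (D.unit B)) (𝟙 A) (𝟙 B) :=
  iso_inv _ (D.src_rightUnitor m) (D.tgt_rightUnitor m)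

end HasCell

/-! ### Unit-purity and invertible cells -/

theorem IsUnitPure.exists_unitMap (h : D.IsUnitPure) {A B : D.Obj}
    (α : D.Cell (D.unit A) (D.unit B)) : ∃ f : A ⟶ B, D.unitMap f = α :=
  let ⟨f, hf⟩ := h.map_surjective α
  ⟨f, hf⟩

/-- Such a cell is `y k` for some `k`, and both its sides are `k`. Commutativity, monicity and
epicness are all derived from this. -/
theorem IsUnitPure.src_eq_tgt (h : D.IsUnitPure) {A B : D.Obj} {f g : A ⟶ B}
    (hc : D.HasCell (D.unit A) (D.unit B) f g) : f = g := by
  obtain ⟨α, rfl, rfl⟩ := hc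
  obtain ⟨k, rfl⟩ := h.exists_unitMap α
  rw [D.src_unitMap, D.tgt_unitMap]

theorem IsUnitPure.eq_id (h : D.IsUnitPure) {A : D.Obj} (α : D.Cell (D.unit A) (D.unit A))
    (hα : D.src α = 𝟙 A) : α = 𝟙 _ := by
  obtain ⟨k, rfl⟩ := h.exists_unitMap α
  rw [D.src_unitMap] at hα
  rw [hα, D.unitMap_id]

/-- An invertible globular cell admits a globular cell in the reverse direction. -/
theorem hasCell_of_isIso {A B : D.Obj} {m n : D.Pro A B} (α : D.Cell m n) [IsIso α]
    (hs : D.src α = 𝟙 A) (ht : D.tgt α = 𝟙 B) : D.HasCell n m (𝟙 A) (𝟙 B) :=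
  HasCell.iso_inv (asIso α) hs ht

theorem hcomp_isIso {A B C A' B' C' : D.Obj} {m : D.Pro A B} {n : D.Pro B C} {m' : D.Pro A' B'}
    {n' : D.Pro B' C'} (α : D.Cell m m') (β : D.Cell n n') (h : D.tgt α = D.src β)
    (α' : D.Cell m' m) (β' : D.Cell n' n) (h' : D.tgt α' = D.src β')
    (h₁ : α ≫ α' = 𝟙 _) (h₂ : α' ≫ α = 𝟙 _) (h₃ : β ≫ β' = 𝟙 _) (h₄ : β' ≫ β = 𝟙 _) :
    IsIso (D.hcomp α β h) := by
  refine ⟨D.hcomp α' β' h', ?_, ?_⟩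
  · rw [← D.hcomp_comp]; simp only [h₁, h₃, D.hcomp_id]
  · rw [← D.hcomp_comp]; simp only [h₂, h₄, D.hcomp_id]

/-! ### Products of arrows and proarrows -/

namespace Cartesian

variable (K : D.Cartesian)

theorem comp_pair {X Y A B : D.Obj} (a : Y ⟶ X) (f : X ⟶ A) (g : X ⟶ B) :
    a ≫ K.pair f g = K.pair (a ≫ f) (a ≫ g) := by
  have h : a ≫ K.diagonal X =
      K.diagonal Y ≫ K.prodFunctor.base.map (X := (Y, Y)) (Y := (X, X)) (a, a) :=
    K.prodAdj.unit.naturality a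
  unfold pair
  rw [← Category.assoc, h, Category.assoc, ← K.prodFunctor.base.map_comp]
  rfl

theorem hasCell_diagonal {A B : D.Obj} (m : D.Pro A B) :
    D.HasCell m (K.prodPro m m) (K.diagonal A) (K.diagonal B) :=
  ⟨K.prodAdj.unit.cell m, K.prodAdj.unit.src_cell m, K.prodAdj.unit.tgt_cell m⟩

/-- The first projection. -/
def fst (A B : D.Obj) : K.prodObj A B ⟶ A := (K.prodAdj.counit.app (A, B)).1

theorem diagonal_fst (A : D.Obj) : K.diagonal A ≫ K.fst A A = 𝟙 A :=
  congrArg Prod.fst (K.prodAdj.left_triangle_app A)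

theorem hasCell_fst {A B A' B' : D.Obj} (m : D.Pro A B) (n : D.Pro A' B') :
    D.HasCell (K.prodPro m n) m (K.fst A A') (K.fst B B') :=
  ⟨(K.prodAdj.counit.cell (A := (A, A')) (B := (B, B')) (m, n)).1,
    congrArg Prod.fst (K.prodAdj.counit.src_cell (A := (A, A')) (B := (B, B')) (m, n)),
    congrArg Prod.fst (K.prodAdj.counit.tgt_cell (A := (A, A')) (B := (B, B')) (m, n))⟩

theorem hasCell_prod {A B : D.Obj} {m m' n n' : D.Pro A B}
    (h : D.HasCell m m' (𝟙 A) (𝟙 B)) (h' : D.HasCell n n' (𝟙 A) (𝟙 B)) :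
    D.HasCell (K.prodPro m n) (K.prodPro m' n') (𝟙 _) (𝟙 _) := by
  obtain ⟨α, hα, hα'⟩ := h
  obtain ⟨β, hβ, hβ'⟩ := h'
  let γ : (D.prod D).Cell (A := (A, A)) (B := (B, B)) (A' := (A, A)) (B' := (B, B))
    (m, n) (m', n') := (α, β)
  refine ⟨K.prodFunctor.cell γ, (K.prodFunctor.src_cell γ).trans ?_,
    (K.prodFunctor.tgt_cell γ).trans ?_⟩
  · rw [← K.prodFunctor.base.map_id]
    exact congrArg _ (Prod.ext hα hβ)
  · rw [← K.prodFunctor.base.map_id]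
    exact congrArg _ (Prod.ext hα' hβ')

end Cartesian

/-! ### Companions, conjoints, covers and inclusions -/

namespace Equipment

variable (Q : D.Equipment)

theorem companion_unit {A B : D.Obj} (f : A ⟶ B) :
    D.HasCell (D.unit A) (Q.lower f) (𝟙 A) f :=
  ⟨_, (Q.companion f).src_unit, (Q.companion f).tgt_unit⟩

theorem companion_counit {A B : D.Obj} (f : A ⟶ B) :
    D.HasCell (Q.lower f) (D.unit B) f (𝟙 B) :=
  ⟨_, (Q.companion f).src_counit, (Q.companion f).tgt_counit⟩

theorem conjoint_unit {A B : D.Obj} (f : A ⟶ B) :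
    D.HasCell (D.unit A) (Q.upper f) f (𝟙 A) :=
  ⟨_, (Q.conjoint f).src_unit, (Q.conjoint f).tgt_unit⟩

theorem conjoint_counit {A B : D.Obj} (f : A ⟶ B) :
    D.HasCell (Q.upper f) (D.unit B) (𝟙 B) f :=
  ⟨_, (Q.conjoint f).src_counit, (Q.conjoint f).tgt_counit⟩

theorem src_coverCell {A B : D.Obj} (f : A ⟶ B) : D.src (Q.coverCell f) = 𝟙 B := by
  rw [coverCell, D.src_comp, D.src_hcomp, (Q.conjoint f).src_counit, D.src_leftUnitor]
  exact Category.comp_id _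

theorem tgt_coverCell {A B : D.Obj} (f : A ⟶ B) : D.tgt (Q.coverCell f) = 𝟙 B := by
  rw [coverCell, D.tgt_comp, D.tgt_hcomp, (Q.companion f).tgt_counit, D.tgt_leftUnitor]
  exact Category.comp_id _

theorem src_inclusionCell {A B : D.Obj} (f : A ⟶ B) : D.src (Q.inclusionCell f) = 𝟙 A := by
  rw [inclusionCell, D.src_comp, D.src_hcomp, (Q.companion f).src_unit,
    D.src_inv (D.leftUnitor (D.unit A)) (A := A) rfl rfl (D.src_leftUnitor _)]
  exact Category.comp_id _

theorem tgt_inclusionCell {A B : D.Obj} (f : A ⟶ B) : D.tgt (Q.inclusionCell f) = 𝟙 A := by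
  rw [inclusionCell, D.tgt_comp, D.tgt_hcomp, (Q.conjoint f).tgt_unit,
    D.tgt_inv (D.leftUnitor (D.unit A)) (A := A) rfl rfl (D.tgt_leftUnitor _)]
  exact Category.comp_id _

theorem src_cokernel {A B : D.Obj} (f : A ⟶ B) : D.src (Q.cokernel f) = f := by
  rw [cokernel, D.src_comp, D.src_hcomp, (Q.conjoint f).src_unit,
    D.src_inv (D.leftUnitor (D.unit A)) (A := A) rfl rfl (D.src_leftUnitor _)]
  exact Category.id_comp _

theorem tgt_cokernel {A B : D.Obj} (f : A ⟶ B) : D.tgt (Q.cokernel f) = f := by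
  rw [cokernel, D.tgt_comp, D.tgt_hcomp, (Q.companion f).tgt_unit,
    D.tgt_inv (D.leftUnitor (D.unit A)) (A := A) rfl rfl (D.tgt_leftUnitor _)]
  exact Category.id_comp _

/-- A pair of arrows with `a ≫ f = b ≫ g` gives a cell `y_X ⇒ f_! ⊗ g^*`. -/
theorem hasCell_cospan {X A B C : D.Obj} {f : A ⟶ C} {g : B ⟶ C} {a : X ⟶ A} {b : X ⟶ B}
    (h : a ≫ f = b ≫ g) : D.HasCell (D.unit X) (D.tensor (Q.lower f) (Q.upper g)) a b := by
  have h₁ : D.HasCell (D.unit X) (Q.lower f) a (a ≫ f) := by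
    simpa using (HasCell.unit a).comp (Q.companion_unit f)
  have h₂ : D.HasCell (D.unit X) (Q.upper g) (a ≫ f) b := by
    simpa [h] using (HasCell.unit b).comp (Q.conjoint_unit g)
  exact (HasCell.leftUnitor_inv _).of_glob (h₁.tensor h₂)

/-- Converse of `hasCell_cospan`: the two counits collapse `f_! ⊗ g^*` onto the unit of `C`. -/
theorem cospan_w (hpure : D.IsUnitPure) {X A B C : D.Obj} {f : A ⟶ C} {g : B ⟶ C} {a : X ⟶ A}
    {b : X ⟶ B} (h : D.HasCell (D.unit X) (D.tensor (Q.lower f) (Q.upper g)) a b) :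
    a ≫ f = b ≫ g :=
  hpure.src_eq_tgt <| (h.comp ((Q.companion_counit f).tensor (Q.conjoint_counit g))).glob
    (HasCell.leftUnitor _)

/-- Cells out of `e^* ⊗ e_!` from cells out of `y`. -/
theorem hasCell_extension {A E X Y : D.Obj} {e : A ⟶ E} {q : D.Pro X Y} {g : E ⟶ X} {k : E ⟶ Y}
    (h : D.HasCell (D.unit A) q (e ≫ g) (e ≫ k)) :
    D.HasCell (D.tensor (Q.upper e) (Q.lower e)) q g k := by
  have h₁ : D.HasCell (Q.upper e) (D.unit X) g (e ≫ g) := by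
    simpa using (Q.conjoint_counit e).comp (HasCell.unit g)
  have h₂ : D.HasCell (Q.lower e) (D.unit Y) (e ≫ k) k := by
    simpa using (Q.companion_counit e).comp (HasCell.unit k)
  -- The given cell is pasted between the two counits: `e^* ⊗ (y_A ⊗ e_!) ⇒ y_X ⊗ (q ⊗ y_Y)`.
  exact (((HasCell.refl _).tensor (HasCell.leftUnitor_inv _)).of_glob
    (h₁.tensor (h.tensor h₂))).glob
      ((HasCell.leftUnitor _).glob (HasCell.rightUnitor _))

theorem companion_ext {A E : D.Obj} (e : A ⟶ E) {X Y : D.Obj} {q : D.Pro X Y}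
    {α β : D.Cell (Q.lower e) q} (ht : D.tgt α = D.tgt β)
    (h : (Q.companion e).unit ≫ α = (Q.companion e).unit ≫ β) : α = β := by
  -- The companion identity rebuilds `γ` from its restriction along the unit and its target arrow.
  have key : ∀ γ : D.Cell (Q.lower e) q,
      γ = (D.leftUnitor _).inv ≫ D.hcomp ((Q.companion e).unit ≫ γ)
        ((Q.companion e).counit ≫ D.unitMap (D.tgt γ))
        (by rw [D.tgt_comp, D.src_comp, (Q.companion e).tgt_unit, (Q.companion e).src_counit,
          D.src_unitMap]) ≫ (D.rightUnitor q).hom := by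
    intro γ
    rw [D.hcomp_comp _ _ _ _ (by rw [(Q.companion e).tgt_unit, (Q.companion e).src_counit])
      (by rw [D.src_unitMap]), (Q.companion e).unit_hcomp_counit, Category.assoc,
      D.rightUnitor_naturality]
    simp
  rw [key α, key β]
  simp only [h, ht]

theorem conjoint_tensor_ext {A E Z : D.Obj} (e : A ⟶ E) (n : D.Pro A Z) {X Y : D.Obj}
    {q : D.Pro X Y} {α β : D.Cell (D.tensor (Q.upper e) n) q} (hs : D.src α = D.src β)
    (h : D.hcomp (Q.conjoint e).unit (𝟙 (Proarrow.of n))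
        (by rw [(Q.conjoint e).tgt_unit, D.src_id]) ≫ α =
      D.hcomp (Q.conjoint e).unit (𝟙 (Proarrow.of n))
        (by rw [(Q.conjoint e).tgt_unit, D.src_id]) ≫ β) : α = β := by
  have hw : D.tgt (Q.conjoint e).unit = D.src (𝟙 (Proarrow.of n)) := by
    rw [(Q.conjoint e).tgt_unit, D.src_id]
  have hv : D.tgt (Q.conjoint e).counit = D.src (Q.conjoint e).unit := by
    rw [(Q.conjoint e).tgt_counit, (Q.conjoint e).src_unit]
  have hv' : D.tgt (Q.conjoint e).counit = D.src (D.hcomp (Q.conjoint e).unit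
      (𝟙 (Proarrow.of n)) hw) := by rw [D.src_hcomp, hv]
  -- Up to associators this is the conjoint identity tensored with `n`.
  have hiso : IsIso (D.hcomp (Q.conjoint e).counit (D.hcomp (Q.conjoint e).unit
      (𝟙 (Proarrow.of n)) hw) hv') := by
    have hn := D.assoc_naturality (Q.conjoint e).counit (Q.conjoint e).unit
      (𝟙 (Proarrow.of n)) hv hw
    have hi : IsIso (D.hcomp (D.hcomp (Q.conjoint e).counit (Q.conjoint e).unit hv)
        (𝟙 (Proarrow.of n)) (by rw [D.tgt_hcomp, hw])) := by
      refine D.hcomp_isIso _ _ _ ((D.leftUnitor _).hom ≫ (D.rightUnitor _).inv) (𝟙 _) ?_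
        ?_ ?_ ?_ ?_
      · rw [D.tgt_comp, D.tgt_leftUnitor, D.src_id,
          D.tgt_inv (D.rightUnitor (Q.upper e)) (A := A) rfl rfl (D.tgt_rightUnitor _)]
        exact Category.comp_id _
      all_goals simp [(Q.conjoint e).counit_hcomp_unit]
    rw [← Iso.inv_comp_eq] at hn
    rw [← hn]
    infer_instance
  -- The right side depends on `γ` only through its source and its restriction along the conjoint
  -- unit; the left side is `γ` preceded by isomorphisms.
  have key : ∀ γ : D.Cell (D.tensor (Q.upper e) n) q,
      D.hcomp (Q.conjoint e).counit (D.hcomp (Q.conjoint e).unit (𝟙 (Proarrow.of n)) hw) hv' ≫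
        (D.leftUnitor _).hom ≫ γ =
      D.hcomp ((Q.conjoint e).counit ≫ D.unitMap (D.src γ))
        (D.hcomp (Q.conjoint e).unit (𝟙 (Proarrow.of n)) hw ≫ γ)
        (by rw [D.tgt_comp, D.src_comp, D.tgt_unitMap, hv']) ≫ (D.leftUnitor q).hom := by
    intro γ
    rw [D.hcomp_comp _ _ _ _ hv' (D.tgt_unitMap _), Category.assoc, D.leftUnitor_naturality]
  rw [← cancel_epi (D.leftUnitor _).hom, ← cancel_epi (D.hcomp (Q.conjoint e).counit
    (D.hcomp (Q.conjoint e).unit (𝟙 (Proarrow.of n)) hw) hv'), key α, key β]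
  simp only [h, hs]

/-- Splits the cokernel into a companion unit and a conjoint unit, so that `companion_ext` and
`conjoint_tensor_ext` apply in turn. -/
theorem cokernel_eq {A E : D.Obj} (e : A ⟶ E) :
    Q.cokernel e = (Q.companion e).unit ≫ (D.leftUnitor _).inv ≫
      D.hcomp (Q.conjoint e).unit (𝟙 (Proarrow.of (Q.lower e)))
        (by rw [(Q.conjoint e).tgt_unit, D.src_id]) := by
  have hn := D.leftUnitor_naturality (Q.companion e).unit
  rw [← Iso.inv_comp_eq, ← Category.assoc, ← Iso.eq_comp_inv] at hn
  rw [← Category.assoc, ← hn, cokernel, Category.assoc, ← D.hcomp_comp]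
  simp only [(Q.companion e).src_unit, D.unitMap_id, Category.id_comp, Category.comp_id]

/-- The cokernel cell is jointly epimorphic with the boundary. -/
theorem cokernel_ext {A E : D.Obj} (e : A ⟶ E) {X Y : D.Obj} {q : D.Pro X Y}
    {α β : D.Cell (D.tensor (Q.upper e) (Q.lower e)) q} (hs : D.src α = D.src β)
    (ht : D.tgt α = D.tgt β) (h : Q.cokernel e ≫ α = Q.cokernel e ≫ β) : α = β := by
  refine Q.conjoint_tensor_ext e _ hs ?_
  rw [← cancel_epi (D.leftUnitor _).inv]
  refine Q.companion_ext e ?_ ?_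
  · simp only [D.tgt_comp, ht]
  · simpa only [cokernel_eq, Category.assoc] using h

/-- If `a ≫ m = b ≫ m`, the cell `y_X ⇒ m_! ⊗ m^*` with sides `a`, `b` composes with the inverse of
the inclusion cell to a cell between units. -/
theorem mono_of_inclusion (hpure : D.IsUnitPure) {A B : D.Obj} (m : A ⟶ B)
    (hm : Q.inclusions m) : Mono m where
  right_cancellation a b h := by
    have : IsIso (Q.inclusionCell m) := hm
    exact hpure.src_eq_tgt <| (Q.hasCell_cospan h).glob
      (D.hasCell_of_isIso _ (Q.src_inclusionCell m) (Q.tgt_inclusionCell m))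

theorem hasCell_of_cover {A B : D.Obj} {e : A ⟶ B} (he : Q.covers e) :
    D.HasCell (D.unit B) (D.tensor (Q.upper e) (Q.lower e)) (𝟙 B) (𝟙 B) :=
  have : IsIso (Q.coverCell e) := he
  D.hasCell_of_isIso _ (Q.src_coverCell e) (Q.tgt_coverCell e)

/-- If `e ≫ g = e ≫ k`, the unit cell on this arrow extends to `e^* ⊗ e_!` with sides `g`, `k`; the
inverse cover cell brings it back to units. -/
theorem epi_of_cover (hpure : D.IsUnitPure) {A B : D.Obj} (e : A ⟶ B) (he : Q.covers e) :
    Epi e where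
  left_cancellation g k h := hpure.src_eq_tgt <| (Q.hasCell_of_cover he).of_glob <|
    Q.hasCell_extension (by rw [h]; exact HasCell.unit _)

/-- The pairing into `m ∧ n`: the diagonal cell of `p`, factored through the restriction by
companion and conjoint units. -/
theorem hasCell_localProd (K : D.Cartesian) {A B : D.Obj} {p m n : D.Pro A B}
    (h : D.HasCell p m (𝟙 A) (𝟙 B)) (h' : D.HasCell p n (𝟙 A) (𝟙 B)) :
    D.HasCell p (Q.localProd K m n) (𝟙 A) (𝟙 B) :=
  (HasCell.leftUnitor_inv p).of_glob <| (HasCell.rightUnitor_inv _).of_glob <|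
    ((Q.companion_unit _).tensor ((K.hasCell_diagonal p).glob (K.hasCell_prod h h'))).tensor
      (Q.conjoint_unit _)

theorem hasCell_localProd_fst (K : D.Cartesian) {A B : D.Obj} (m n : D.Pro A B) :
    D.HasCell (Q.localProd K m n) m (𝟙 A) (𝟙 B) := by
  have h : D.HasCell (Q.localProd K m n) (K.prodPro m n) (K.diagonal A) (K.diagonal B) :=
    (((Q.companion_counit _).tensor (HasCell.refl _)).tensor (Q.conjoint_counit _)).glob
      ((HasCell.rightUnitor _).glob (HasCell.leftUnitor _))
  simpa only [K.diagonal_fst] using h.comp (K.hasCell_fst m n)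

end Equipment

/-! ### Tabulators as representing objects for cells out of units -/

namespace Tabulators

variable (T : D.Tabulators)

/-- The tabulator of a proarrow. -/
abbrev tab {A B : D.Obj} (p : D.Pro A B) : D.Obj := T.top.obj (Proarrow.of p)

/-- The tabulator cell. -/
abbrev cell {A B : D.Obj} (p : D.Pro A B) : D.Cell (D.unit (T.tab p)) p :=
  T.adj.counit.app (Proarrow.of p)

/-- The source of the tabulator cell. -/
abbrev l {A B : D.Obj} (p : D.Pro A B) : T.tab p ⟶ A := D.src (T.cell p)

/-- The target of the tabulator cell. -/
abbrev r {A B : D.Obj} (p : D.Pro A B) : T.tab p ⟶ B := D.tgt (T.cell p)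

theorem hasCell {A B : D.Obj} (p : D.Pro A B) : D.HasCell (D.unit (T.tab p)) p (T.l p) (T.r p) :=
  ⟨T.cell p, rfl, rfl⟩

theorem exists_lift_cell {X A B : D.Obj} {p : D.Pro A B} (θ : D.Cell (D.unit X) p) :
    ∃ s : X ⟶ T.tab p, D.unitMap s ≫ T.cell p = θ ∧ s ≫ T.l p = D.src θ ∧ s ≫ T.r p = D.tgt θ := by
  obtain ⟨s, hs⟩ : ∃ s : X ⟶ T.tab p, D.unitMap s ≫ T.cell p = θ :=
    ⟨T.adj.homEquiv X (Proarrow.of p) θ,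
      (T.adj.homEquiv_counit _ _ _).symm.trans ((T.adj.homEquiv X (Proarrow.of p)).symm_apply_apply θ)⟩
  refine ⟨s, hs, ?_, ?_⟩
  · rw [← hs, D.src_comp, D.src_unitMap]
  · rw [← hs, D.tgt_comp, D.tgt_unitMap]

theorem exists_lift {X A B : D.Obj} {p : D.Pro A B} {f : X ⟶ A} {g : X ⟶ B}
    (h : D.HasCell (D.unit X) p f g) : ∃ s : X ⟶ T.tab p, s ≫ T.l p = f ∧ s ≫ T.r p = g := by
  obtain ⟨θ, rfl, rfl⟩ := h
  obtain ⟨s, -, h₁, h₂⟩ := T.exists_lift_cell θ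
  exact ⟨s, h₁, h₂⟩

end Tabulators

/-! ### The orthogonal factorization system -/

namespace Equipment

variable (Q : D.Equipment) {K : D.Cartesian} {T : D.Tabulators}

/-- The legs of a tabulator are jointly monic. -/
theorem tab_hom_ext (hpure : D.IsUnitPure) (htab : Q.TabulatorsJointlyInclusions K T)
    {X A B : D.Obj} {p : D.Pro A B} {s s' : X ⟶ T.tab p} (hl : s ≫ T.l p = s' ≫ T.l p)
    (hr : s ≫ T.r p = s' ≫ T.r p) : s = s' := by
  have := Q.mono_of_inclusion hpure _ (htab (Proarrow.of p))
  rw [← cancel_mono (K.pair (T.l p) (T.r p)), K.comp_pair, K.comp_pair, hl, hr]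

/-- Cells out of external units are determined by their boundary. -/
theorem unit_cell_ext (hpure : D.IsUnitPure) (htab : Q.TabulatorsJointlyInclusions K T)
    {X A B : D.Obj} {p : D.Pro A B} {θ θ' : D.Cell (D.unit X) p} (hs : D.src θ = D.src θ')
    (ht : D.tgt θ = D.tgt θ') : θ = θ' := by
  obtain ⟨s, rfl, hl, hr⟩ := T.exists_lift_cell θ
  obtain ⟨s', rfl, hl', hr'⟩ := T.exists_lift_cell θ'
  rw [Q.tab_hom_ext hpure htab (hl.trans (hs.trans hl'.symm)) (hr.trans (ht.trans hr'.symm))]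

theorem cover_of_hasCell (hpure : D.IsUnitPure) (htab : Q.TabulatorsJointlyInclusions K T)
    {A E : D.Obj} {e : A ⟶ E}
    (h : D.HasCell (D.unit E) (D.tensor (Q.upper e) (Q.lower e)) (𝟙 E) (𝟙 E)) : Q.covers e := by
  obtain ⟨σ, hs, ht⟩ := h
  have hs' : D.src (Q.coverCell e ≫ σ) = 𝟙 E := by
    rw [D.src_comp, hs, Q.src_coverCell]; exact Category.comp_id _
  have ht' : D.tgt (Q.coverCell e ≫ σ) = 𝟙 E := by
    rw [D.tgt_comp, ht, Q.tgt_coverCell]; exact Category.comp_id _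
  -- `σ ≫ coverCell` is a globular endocell of a unit, so unit-purity applies. The other composite
  -- is compared with the identity after the cokernel, where both are cells out of a unit.
  refine ⟨σ, Q.cokernel_ext e ?_ ?_ (Q.unit_cell_ext hpure htab ?_ ?_), hpure.eq_id _ ?_⟩
  · rw [hs', D.src_id]
  · rw [ht', D.tgt_id]
  · rw [D.src_comp, hs', D.src_comp, D.src_id]
  · rw [D.tgt_comp, ht', D.tgt_comp, D.tgt_id]
  · rw [D.src_comp, hs, Q.src_coverCell]; exact Category.comp_id _

/-- The two legs of the tabulator of `f^* ⊗ f_!` agree. -/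
theorem tab_cokernel_l_eq_r (hpure : D.IsUnitPure) {A B : D.Obj} (f : A ⟶ B) :
    T.l (D.tensor (Q.upper f) (Q.lower f)) = T.r (D.tensor (Q.upper f) (Q.lower f)) :=
  hpure.src_eq_tgt <| (T.hasCell _).glob ⟨_, Q.src_coverCell f, Q.tgt_coverCell f⟩

theorem tab_cokernel_mono (hpure : D.IsUnitPure) (htab : Q.TabulatorsJointlyInclusions K T)
    {A B : D.Obj} (f : A ⟶ B) : Mono (T.l (D.tensor (Q.upper f) (Q.lower f))) where
  right_cancellation s s' h := Q.tab_hom_ext hpure htab h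
    (by rw [← Q.tab_cokernel_l_eq_r hpure f]; exact h)

theorem tab_cokernel_factor {A B : D.Obj} (f : A ⟶ B) :
    ∃ s : A ⟶ T.tab (D.tensor (Q.upper f) (Q.lower f)), s ≫ T.l _ = f :=
  let ⟨s, hs, _⟩ := T.exists_lift ⟨Q.cokernel f, Q.src_cokernel f, Q.tgt_cokernel f⟩
  ⟨s, hs⟩

/-- An arrow that factors only through split monomorphisms is a cover. -/
theorem cover_of_extremal (hpure : D.IsUnitPure) (htab : Q.TabulatorsJointlyInclusions K T)
    {A E : D.Obj} {e : A ⟶ E}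
    (h : ∀ {I : D.Obj} (s : A ⟶ I) (m : I ⟶ E), Mono m → s ≫ m = e →
      ∃ k : E ⟶ I, k ≫ m = 𝟙 E) : Q.covers e := by
  obtain ⟨s, hs⟩ := Q.tab_cokernel_factor (T := T) e
  obtain ⟨k, hk⟩ := h s _ (Q.tab_cokernel_mono hpure htab e) hs
  refine Q.cover_of_hasCell hpure htab ?_
  -- Both legs of the tabulator are equal, so a section of `l` is also one of `r`, and the resulting
  -- cell is globular.
  have hc := (HasCell.unit k).comp (T.hasCell (D.tensor (Q.upper e) (Q.lower e)))
  rwa [← Q.tab_cokernel_l_eq_r hpure e, hk] at hc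

theorem cover_of_isIso (hpure : D.IsUnitPure) (htab : Q.TabulatorsJointlyInclusions K T)
    {A B : D.Obj} (e : A ⟶ B) [IsIso e] : Q.covers e :=
  Q.cover_of_extremal hpure htab fun s m _ h => ⟨inv e ≫ s, by simp [h]⟩

theorem inclusion_of_mono (hpure : D.IsUnitPure) (htab : Q.TabulatorsJointlyInclusions K T)
    (hbc : Q.BeckChevalley) {A B : D.Obj} (m : A ⟶ B) [Mono m] : Q.inclusions m := by
  -- For this square the Beck–Chevalley cell is the inclusion cell of `m` preceded by the invertible
  -- cover cell of `𝟙 A`.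
  have hp : IsPullback (𝟙 A) (𝟙 A) m m := IsKernelPair.id_of_mono m
  have h₁ : IsIso (Q.beckChevalleyCell hp.w) := hbc hp
  have h₂ : IsIso (Q.coverCell (𝟙 A)) := Q.cover_of_isIso hpure htab (𝟙 A)
  have h₃ : Q.beckChevalleyCell hp.w = Q.coverCell (𝟙 A) ≫ Q.inclusionCell m := by
    rw [beckChevalleyCell, coverCell, inclusionCell, D.hcomp_comp _ _ _ _
      (by rw [(Q.conjoint _).tgt_counit, (Q.companion _).src_counit])
      (by rw [(Q.companion _).tgt_unit, (Q.conjoint _).src_unit])]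
    simp
  rw [h₃] at h₁
  exact IsIso.of_isIso_comp_left (Q.coverCell (𝟙 A)) (Q.inclusionCell m)

/-- An arrow into the codomain of an inclusion `m` lifts through `m` when it carries a cell to the
cokernel of `m`. -/
theorem exists_lift_inclusion (hreg : Q.InclusionsRegular) {X A B : D.Obj} {m : A ⟶ B}
    (hm : Q.inclusions m) {f g : X ⟶ B}
    (h : D.HasCell (D.unit X) (D.tensor (Q.upper m) (Q.lower m)) f g) :
    ∃ k : X ⟶ A, k ≫ m = f := by
  obtain ⟨θ, rfl, rfl⟩ := h
  obtain ⟨k, rfl, -⟩ := hreg m hm X θ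
  exact ⟨k, by rw [D.src_comp, D.src_unitMap, Q.src_cokernel]⟩

/-- A factorization of `f` through `m` induces a cell between cokernels. -/
theorem hasCell_cokernel {A B X : D.Obj} {f : A ⟶ B} {a : A ⟶ X} {m : X ⟶ B} (h : a ≫ m = f) :
    D.HasCell (D.unit A) (D.tensor (Q.upper m) (Q.lower m)) f f := by
  simpa [h] using (HasCell.unit a).comp ⟨Q.cokernel m, Q.src_cokernel m, Q.tgt_cokernel m⟩

theorem exists_filler (hpure : D.IsUnitPure) (hreg : Q.InclusionsRegular) {A B X Y : D.Obj}
    {e : A ⟶ B} {m : X ⟶ Y} {a : A ⟶ X} {b : B ⟶ Y} (he : Q.covers e) (hm : Q.inclusions m)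
    (h : a ≫ m = e ≫ b) : ∃! d : B ⟶ X, e ≫ d = a ∧ d ≫ m = b := by
  have := Q.mono_of_inclusion hpure m hm
  obtain ⟨d, hd⟩ := Q.exists_lift_inclusion hreg hm <|
    (Q.hasCell_of_cover he).of_glob (Q.hasCell_extension (Q.hasCell_cokernel h))
  refine ⟨d, ⟨?_, hd⟩, fun d' hd' => ?_⟩
  · rw [← cancel_mono m, Category.assoc, hd, h]
  · rw [← cancel_mono m, hd, hd'.2]

/-- A monic right factor of `e ≫ g` receives a lift of `g` since `e` is a cover, then a lift of `𝟙
C` since `g` is one; the latter is the splitting. -/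
theorem cover_comp (hpure : D.IsUnitPure) (htab : Q.TabulatorsJointlyInclusions K T)
    (hreg : Q.InclusionsRegular) (hbc : Q.BeckChevalley) {A B C : D.Obj} (e : A ⟶ B) (g : B ⟶ C)
    (he : Q.covers e) (hg : Q.covers g) : Q.covers (e ≫ g) := by
  refine Q.cover_of_extremal hpure htab fun {I} s m _ h => ?_
  have hm := Q.inclusion_of_mono hpure htab hbc m
  obtain ⟨d, ⟨-, hd⟩, -⟩ := Q.exists_filler hpure hreg he hm h
  obtain ⟨k, ⟨-, hk⟩, -⟩ := Q.exists_filler hpure hreg hg hm (a := d) (b := 𝟙 C) (by simp [hd])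
  exact ⟨k, hk⟩

theorem exists_factorization (hpure : D.IsUnitPure) (htab : Q.TabulatorsJointlyInclusions K T)
    (hreg : Q.InclusionsRegular) (hbc : Q.BeckChevalley) {A B : D.Obj} (f : A ⟶ B) :
    ∃ (I : D.Obj) (e : A ⟶ I) (m : I ⟶ B), Q.covers e ∧ Q.inclusions m ∧ e ≫ m = f := by
  obtain ⟨e, he⟩ := Q.tab_cokernel_factor (T := T) f
  have hl := Q.tab_cokernel_mono (T := T) hpure htab f
  refine ⟨_, e, _, Q.cover_of_extremal hpure htab fun {J} s m _ h => ?_,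
    Q.inclusion_of_mono hpure htab hbc _, he⟩
  -- If the left factor of `f` passes through a mono `m`, then `f` factors through the inclusion `m
  -- ≫ l`, so `f^* ⊗ f_!` maps to the cokernel of `m ≫ l`. Regularity lifts `l` through `m ≫ l`, and
  -- cancelling `l` splits `m`.
  have hc : D.HasCell (D.tensor (Q.upper f) (Q.lower f)) _ (𝟙 B) (𝟙 B) := Q.hasCell_extension <| by
    simpa using Q.hasCell_cokernel (a := s) (m := m ≫ T.l (D.tensor (Q.upper f) (Q.lower f)))
      (f := f) (by rw [← Category.assoc, h, he])
  obtain ⟨k, hk⟩ := Q.exists_lift_inclusion hreg (Q.inclusion_of_mono hpure htab hbc _)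
    ((T.hasCell (D.tensor (Q.upper f) (Q.lower f))).glob hc)
  exact ⟨k, by rw [← cancel_mono (T.l (D.tensor (Q.upper f) (Q.lower f))), Category.assoc, hk,
    Category.id_comp]⟩

/-! ### Pullbacks and stability of covers -/

/-- The tabulator of `f_! ⊗ g^*` is a pullback of `f` and `g`. -/
theorem isPullback_tab (hpure : D.IsUnitPure) (htab : Q.TabulatorsJointlyInclusions K T)
    {A B C : D.Obj} (f : A ⟶ C) (g : B ⟶ C) :
    IsPullback (T.l (D.tensor (Q.lower f) (Q.upper g))) (T.r (D.tensor (Q.lower f) (Q.upper g)))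
      f g := by
  have hlift := fun s : Limits.PullbackCone f g => T.exists_lift (Q.hasCell_cospan s.condition)
  choose k hk hk' using hlift
  exact ⟨⟨Q.cospan_w hpure (T.hasCell _)⟩, ⟨Limits.PullbackCone.IsLimit.mk _ k hk hk'
    fun s m hm hm' => Q.tab_hom_ext hpure htab (hm.trans (hk s).symm) (hm'.trans (hk' s).symm)⟩⟩

theorem hasPullbacks (hpure : D.IsUnitPure) (htab : Q.TabulatorsJointlyInclusions K T) :
    Limits.HasPullbacks D.Obj :=
  have : ∀ {A B C : D.Obj} {f : A ⟶ C} {g : B ⟶ C}, Limits.HasLimit (Limits.cospan f g) :=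
    fun {_ _ _ f g} => (Q.isPullback_tab hpure htab f g).hasPullback
  Limits.hasPullbacks_of_hasLimit_cospan _

theorem hasCell_beckChevalley (hbc : Q.BeckChevalley) {P A B C : D.Obj} {p : P ⟶ A} {q : P ⟶ B}
    {f : A ⟶ C} {g : B ⟶ C} (h : IsPullback p q f g) :
    D.HasCell (D.tensor (Q.lower f) (Q.upper g)) (D.tensor (Q.upper p) (Q.lower q))
      (𝟙 A) (𝟙 B) := by
  have : IsIso (Q.beckChevalleyCell h.w) := hbc h
  refine D.hasCell_of_isIso (Q.beckChevalleyCell h.w) ?_ ?_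
  · rw [beckChevalleyCell, D.src_hcomp, D.src_comp, (Q.conjoint p).src_counit,
      (Q.companion f).src_unit]
    exact Category.comp_id _
  · rw [beckChevalleyCell, D.tgt_hcomp, D.tgt_comp, (Q.companion q).tgt_counit,
      (Q.conjoint g).tgt_unit]
    exact Category.comp_id _

theorem cover_pullback (hpure : D.IsUnitPure) (htab : Q.TabulatorsJointlyInclusions K T)
    (hbc : Q.BeckChevalley) (hfrob : Q.Frobenius K) {P A B X : D.Obj} {d : P ⟶ A} {c : P ⟶ B}
    {h : A ⟶ X} {e : B ⟶ X} (hp : IsPullback d c h e) (he : Q.covers e) : Q.covers d := by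
  refine Q.cover_of_hasCell hpure htab ?_
  have h₁ : D.HasCell (D.unit A)
      (D.tensor (Q.upper d) (D.tensor (Q.lower c) (D.tensor (Q.lower e) (Q.upper h))))
      (𝟙 A) (𝟙 A) := by
    -- The chain is `y_A ⇒ h_! ⊗ h^* ⇒ h_! ⊗ e^* ⊗ e_! ⊗ h^* ⇒ d^* ⊗ c_! ⊗ e_! ⊗ h^*`: insert the
    -- cover `e`, then apply Beck–Chevalley.
    refine (Q.hasCell_cospan (f := h) (g := h) rfl).glob ?_
    refine HasCell.glob ?_ (HasCell.assoc _ _ _)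
    refine HasCell.glob ?_ ((Q.hasCell_beckChevalley hbc hp).tensor (HasCell.refl _))
    refine HasCell.glob ((HasCell.refl _).tensor ?_) (HasCell.assoc_inv _ _ _)
    exact (HasCell.leftUnitor_inv _).of_glob <|
      ((Q.hasCell_of_cover he).tensor (HasCell.refl _)).glob (HasCell.assoc _ _ _)
  -- With `q = c_! ⊗ e_! ⊗ h^*`, Frobenius takes `y_A ∧ (d^* ⊗ q)` to `d^* ⊗ ((d_! ⊗ y_A) ∧ q)`; the
  -- first projection then discards `q`, leaving `d^* ⊗ d_!`.
  obtain ⟨φ, hs, ht⟩ := hfrob d (D.unit A)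
    (D.tensor (Q.lower c) (D.tensor (Q.lower e) (Q.upper h)))
  refine (Q.hasCell_localProd K (HasCell.refl _) h₁).glob <| HasCell.of_glob ⟨φ.hom, hs, ht⟩ ?_
  exact (HasCell.refl _).tensor
    ((Q.hasCell_localProd_fst K _ _).glob (HasCell.rightUnitor _))

end Equipment

end DoubleCat

theorem mainTheorem3 (D : DoubleCat.{u, v, w, t}) (Q : D.Equipment) (K : D.Cartesian)
    (hpure : D.IsUnitPure) (T : D.Tabulators) (htab : Q.TabulatorsJointlyInclusions K T)
    (hreg : Q.InclusionsRegular) (hbc : Q.BeckChevalley) (hfrob : Q.Frobenius K) :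
    IsProperFactorizationSystem Q.covers Q.inclusions ∧
      IsStableFactorizationSystem Q.covers Q.inclusions := by
  have hofs : IsOrthogonalFactorizationSystem Q.covers Q.inclusions :=
    { left_isos := fun f _ => Q.cover_of_isIso hpure htab f
      right_isos := fun f _ => Q.inclusion_of_mono hpure htab hbc f
      left_comp := fun f g => Q.cover_comp hpure htab hreg hbc f g
      -- Inclusions coincide with monomorphisms, which compose.
      right_comp := fun f g hf hg => by
        have := Q.mono_of_inclusion hpure f hf
        have := Q.mono_of_inclusion hpure g hg
        exact Q.inclusion_of_mono hpure htab hbc (f ≫ g)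
      factorization := fun f => Q.exists_factorization hpure htab hreg hbc f
      unique_lift := fun _ _ _ _ he hm h => Q.exists_filler hpure hreg he hm h }
  exact ⟨⟨hofs, fun e => Q.epi_of_cover hpure e, fun m => Q.mono_of_inclusion hpure m⟩,
    ⟨hofs, Q.hasPullbacks hpure htab, fun hp he => Q.cover_pullback hpure htab hbc hfrob hp he⟩⟩
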